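/- For a sequence $(x_n)_{n\ge 1}$ in $[0,1]$ and $N \ge 1$ let $$D_N^* = \sup_{0\le t\le 1}\left|\frac{\#\{1\le i\le N : x_i\le t\}}{N}-t\right|$$ be the star discrepancy of its first $N$ elements. Let $S\subset[0,1]$ be a finite set with $m$ elements. Say that $(x_n)_{n\ge1}$ is a greedy sequence with initial set $S$ if $x_1,\dots,x_m$ is an enumeration of $S$ and, for every $N>m$, the point $x_N$ is a minimizer of $$x\mapsto\sum_{k=1}^{N-1}\bigl(1-\log(2\sin(\pi|x-x_k|))\bigr)$$ over the set of all $x\in[0,1]$ with $|x-x_k|\ge N^{-10}$ for all $1\le k\le N-1$; here $-\log 0=+\infty$, and if the minimizer is not unique, any choice is allowed. Then there is a constant $C$, depending only on $S$, such that every greedy sequence with initial set $S$ satisfies $$D_N^*\le C\,\frac{\log N}{\sqrt N}\qquad\text{for all } N\ge 2.$$ -/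

import Mathlib

noncomputable section

namespace GreedySeq

/-- The kernel `1 - log (2 sin (π |t|))` for `|t| ≤ 1`, with values in the extended reals: it is
`+∞` where the sine vanishes (`|t| = 0` or `|t| = 1`), since there the logarithm is `-∞`. -/
def kernel (t : ℝ) : EReal :=
  if 0 < Real.sin (Real.pi * |t|) then
    ((1 - Real.log (2 * Real.sin (Real.pi * |t|)) : ℝ) : EReal)
  else ⊤

/-- `∑_{k=1}^{N-1} (1 - log (2 sin (π |y - x_k|)))`.  Sequences are indexed from `1`;
the value `x 0` plays no role. -/
def energy (x : ℕ → ℝ) (N : ℕ) (y : ℝ) : EReal :=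
  ∑ k ∈ Finset.Ico 1 N, kernel (y - x k)

/-- The points `y ∈ [0,1]` with `min_{1 ≤ k < N} |y - x_k| ≥ N ^ (-10)`. -/
def admissible (x : ℕ → ℝ) (N : ℕ) : Set ℝ :=
  {y | y ∈ Set.Icc (0 : ℝ) 1 ∧ ∀ k ∈ Finset.Ico 1 N, (N : ℝ) ^ (-10 : ℤ) ≤ |y - x k|}

/-- `x 1, x 2, …` is a greedy sequence with initial set `S`: its first `S.card` terms enumerate `S`
(hence are distinct), and every later `x N` is some minimizer of the energy of its predecessors
over the admissible points. -/
def IsGreedy (S : Finset ℝ) (x : ℕ → ℝ) : Prop :=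
  x '' Set.Icc 1 S.card = (S : Set ℝ) ∧
    ∀ N : ℕ, S.card < N →
      x N ∈ admissible x N ∧ IsMinOn (energy x N) (admissible x N) (x N)

/-- The star discrepancy
`D_N^* = sup_{0 ≤ t ≤ 1} |#{1 ≤ i ≤ N : x_i ≤ t} / N - t|`. -/
def starDiscrepancy (x : ℕ → ℝ) (N : ℕ) : ℝ :=
  ⨆ t : Set.Icc (0 : ℝ) 1,
    |(Set.ncard {i : ℕ | 1 ≤ i ∧ i ≤ N ∧ x i ≤ (t : ℝ)} : ℝ) / (N : ℝ) - (t : ℝ)|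

end GreedySeq

end

/-! The kernel is nonnegative with mean `1`, so a minimizer of the energy lies below the average
energy of the points `n ^ (-10)`-far from the earlier ones. These fill almost all of `[0,1]`, whence
`∑_{k<n} -log (2 sin (π |x n - x k|)) ≤ 1` for every greedy `n` (`IsGreedy.sum_neg_log_le`).

The series `∑ r^k cos(kθ) / k` is a bounded version of `-log (2 sin (θ/2))`, and its double sum over
pairs of points is `∑ r^k |S_k|² / k`, where `S_k` are the exponential sums. With `1 - r` of order
`N ^ (-2)` the diagonal costs `O(log N)` per point, as does each pair inside `S`; greedy steps cost
`O(1)`. Hence `∑_{k ≤ N²} |S_k|² / k = O(N log N)`, and Cauchy–Schwarz against the harmonic sum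
gives `∑ |S_k| / k = O(√N log N)`. An Erdős–Turán type inequality (`abs_smoothedSum_le`,
`abs_card_sub_le_of_smoothedSum_le`) turns this into discrepancy. -/

/-! ### Fourier series of the regularized logarithm and of the Bernoulli polynomial. -/

/-- Real part of the Taylor series of `-log (1 - r e^{iθ})`; the term `k = 0` vanishes since `1 / 0
= 0`. -/
theorem hasSum_pow_div_mul_cos {r : ℝ} (h0 : 0 ≤ r) (h1 : r < 1) (θ : ℝ) :
    HasSum (fun k : ℕ => r ^ k / k * Real.cos (k * θ))
      (-(1 / 2) * Real.log (1 - 2 * r * Real.cos θ + r ^ 2)) := by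
  have hz : ‖(r : ℂ) * Complex.exp (θ * Complex.I)‖ < 1 := by
    rw [norm_mul, Complex.norm_exp_ofReal_mul_I, Complex.norm_real, Real.norm_eq_abs,
      abs_of_nonneg h0, mul_one]
    exact h1
  have key := Complex.hasSum_re (Complex.hasSum_taylorSeries_neg_log hz)
  convert key using 1
  · funext k
    rw [mul_pow, ← Complex.exp_nat_mul, ← mul_assoc, ← Complex.ofReal_pow, mul_div_right_comm,
      ← Complex.ofReal_natCast k, ← Complex.ofReal_div, ← Complex.ofReal_mul,
      Complex.re_ofReal_mul, Complex.exp_ofReal_mul_I_re]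
  · rw [Complex.neg_re, Complex.log_re]
    have : 1 - 2 * r * Real.cos θ + r ^ 2
        = ‖1 - (r : ℂ) * Complex.exp (θ * Complex.I)‖ ^ 2 := by
      rw [← Complex.normSq_eq_norm_sq, Complex.normSq_apply]
      simp only [Complex.sub_re, Complex.one_re, Complex.re_ofReal_mul, Complex.exp_ofReal_mul_I_re,
        Complex.sub_im, Complex.one_im, Complex.im_ofReal_mul, Complex.exp_ofReal_mul_I_im]
      linear_combination -(r ^ 2) * Real.sin_sq_add_cos_sq θ
    rw [this, Real.log_pow]
    push_cast
    ring

theorem log_poisson_le_neg_log_one_sub {r : ℝ} (h0 : 0 ≤ r) (h1 : r < 1) (θ : ℝ) :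
    -(1 / 2) * Real.log (1 - 2 * r * Real.cos θ + r ^ 2) ≤ -Real.log (1 - r) := by
  have h : Real.log ((1 - r) ^ 2) ≤ Real.log (1 - 2 * r * Real.cos θ + r ^ 2) := by
    apply Real.log_le_log (pow_pos (sub_pos.2 h1) 2)
    nlinarith [mul_le_mul_of_nonneg_left (Real.cos_le_one θ) h0]
  rw [Real.log_pow] at h
  push_cast at h
  linarith

/-- With `s = sin (π |t|)`, the argument on the left is `(1 - r)² + 4 r s² ≥ r (2 s)²`. -/
theorem log_poisson_le_neg_log_sin {r : ℝ} (h0 : 0 < r) (t : ℝ)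
    (ht : 0 < Real.sin (Real.pi * |t|)) :
    -(1 / 2) * Real.log (1 - 2 * r * Real.cos (2 * Real.pi * t) + r ^ 2)
      ≤ -Real.log (2 * Real.sin (Real.pi * |t|)) + 1 / 2 * (1 / r - 1) := by
  have hc : Real.cos (2 * Real.pi * t) = 1 - 2 * Real.sin (Real.pi * |t|) ^ 2 := by
    have h : Real.cos (2 * Real.pi * t) = Real.cos (2 * (Real.pi * |t|)) := by
      rw [← Real.cos_abs, abs_mul, abs_of_pos (by positivity : 0 < 2 * Real.pi), mul_assoc]
    rw [h, Real.cos_two_mul, Real.cos_sq']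
    ring
  set s := Real.sin (Real.pi * |t|)
  have h : Real.log (r * (2 * s) ^ 2) ≤ Real.log (1 - 2 * r * Real.cos (2 * Real.pi * t) + r ^ 2) := by
    apply Real.log_le_log (by positivity)
    rw [hc]
    nlinarith [sq_nonneg (1 - r)]
  rw [Real.log_mul h0.ne' (by positivity), Real.log_pow] at h
  have h2 := Real.log_le_sub_one_of_pos (one_div_pos.2 h0)
  rw [one_div, Real.log_inv] at h2
  push_cast at h
  rw [one_div r]
  linarith

theorem hasSum_cos_div_sq {y : ℝ} (hy : |y| ≤ 1) :
    HasSum (fun k : ℕ => 1 / (k : ℝ) ^ 2 * Real.cos (2 * Real.pi * k * y))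
      (Real.pi ^ 2 * (y ^ 2 - |y| + 1 / 6)) := by
  have h := hasSum_one_div_nat_pow_mul_cos one_ne_zero (x := |y|) ⟨abs_nonneg y, hy⟩
  convert h using 1
  · funext k
    have : Real.cos (2 * Real.pi * k * y) = Real.cos (2 * Real.pi * k * |y|) := by
      rw [← Real.cos_abs, abs_mul, abs_of_nonneg (by positivity : 0 ≤ 2 * Real.pi * (k : ℝ))]
    rw [this, mul_one]
  · have : (Polynomial.map (algebraMap ℚ ℝ) (Polynomial.bernoulli (2 * 1))).eval |y|
        = y ^ 2 - |y| + 1 / 6 := by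
      rw [mul_one, Polynomial.bernoulli]
      simp [Finset.sum_range_succ, Polynomial.eval_add]
      ring
    rw [this]
    simp only [mul_one, Nat.factorial_two, Nat.cast_ofNat]
    ring

/-! ### Positivity and mean value of the kernel. -/

theorem one_sub_log_two_sin_nonneg (t : ℝ) :
    0 ≤ 1 - Real.log (2 * Real.sin (Real.pi * t)) := by
  rcases eq_or_ne (2 * Real.sin (Real.pi * t)) 0 with h | h
  · simp [h]
  · have h1 := Real.log_le_sub_one_of_pos (abs_pos.2 h)
    rw [Real.log_abs, abs_mul, abs_of_pos (by norm_num : (0 : ℝ) < 2)] at h1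
    linarith [Real.abs_sin_le_one (Real.pi * t)]

theorem one_sub_log_two_sin_eq {t : ℝ} (h0 : t ≠ 0) (h1 : |t| < 1) :
    1 - Real.log (2 * Real.sin (Real.pi * t))
      = (1 - Real.log 2) - Real.log (Real.sin (Real.pi * t)) := by
  have : Real.sin (Real.pi * t) ≠ 0 := by
    rw [ne_eq, Real.sin_eq_zero_iff_of_lt_of_lt]
    · simp [h0, Real.pi_ne_zero]
    · nlinarith [Real.pi_pos, abs_lt.1 h1]
    · nlinarith [Real.pi_pos, abs_lt.1 h1]
  rw [Real.log_mul two_ne_zero this]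
  ring

theorem one_sub_log_two_sin_periodic :
    Function.Periodic (fun t : ℝ => 1 - Real.log (2 * Real.sin (Real.pi * t))) 1 := by
  intro t
  simp only [mul_add, mul_one, Real.sin_add_pi, mul_neg, Real.log_neg_eq_log]

theorem one_sub_log_two_sin_ae_eq :
    (fun t : ℝ => 1 - Real.log (2 * Real.sin (Real.pi * t)))
      =ᵐ[MeasureTheory.volume.restrict (Set.uIoc (0 : ℝ) 1)]
      (fun t => (1 - Real.log 2) - Real.log (Real.sin (Real.pi * t))) := by
  rw [Filter.EventuallyEq, MeasureTheory.ae_restrict_iff' measurableSet_uIoc]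
  have h1 : ∀ᵐ t : ℝ, t ≠ 1 := by
    simp [MeasureTheory.ae_iff]
  filter_upwards [h1] with t ht hmem
  rw [Set.uIoc_of_le zero_le_one] at hmem
  apply one_sub_log_two_sin_eq hmem.1.ne'
  rw [abs_of_pos hmem.1]
  exact lt_of_le_of_ne hmem.2 ht

theorem intervalIntegrable_log_sin_pi_mul :
    IntervalIntegrable (fun t : ℝ => Real.log (Real.sin (Real.pi * t))) MeasureTheory.volume 0 1 := by
  have h := (intervalIntegrable_log_sin (a := 0) (b := Real.pi)).comp_mul_left (c := Real.pi)
  simpa [Real.pi_ne_zero, Function.comp_def] using h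

theorem intervalIntegrable_one_sub_log_two_sin (a b : ℝ) :
    IntervalIntegrable (fun t : ℝ => 1 - Real.log (2 * Real.sin (Real.pi * t)))
      MeasureTheory.volume a b := by
  apply one_sub_log_two_sin_periodic.intervalIntegrable₀ one_ne_zero
  exact (intervalIntegrable_const.sub intervalIntegrable_log_sin_pi_mul).congr_ae
    one_sub_log_two_sin_ae_eq.symm

theorem integral_one_sub_log_two_sin (x : ℝ) :
    ∫ y in (0 : ℝ)..1, (1 - Real.log (2 * Real.sin (Real.pi * (y - x)))) = 1 := by
  rw [intervalIntegral.integral_comp_sub_right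
    (fun t => 1 - Real.log (2 * Real.sin (Real.pi * t))) x]
  have hp := one_sub_log_two_sin_periodic.intervalIntegral_add_eq (0 - x) 0
  rw [show (0 - x + 1 : ℝ) = 1 - x by ring, zero_add] at hp
  rw [hp, intervalIntegral.integral_congr_ae_restrict one_sub_log_two_sin_ae_eq,
    intervalIntegral.integral_sub intervalIntegrable_const intervalIntegrable_log_sin_pi_mul,
    intervalIntegral.integral_comp_mul_left (fun u => Real.log (Real.sin u)) Real.pi_ne_zero,
    mul_zero, mul_one, integral_log_sin_zero_pi]
  have := Real.pi_ne_zero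
  simp
  field_simp
  ring

theorem log_two_sin_abs {t : ℝ} :
    Real.log (2 * Real.sin (Real.pi * |t|)) = Real.log (2 * Real.sin (Real.pi * t)) := by
  rcases abs_cases t with ⟨h, -⟩ | ⟨h, -⟩ <;> rw [h]
  rw [mul_neg, Real.sin_neg, mul_neg, Real.log_neg_eq_log]

theorem sin_pi_mul_abs_pos {t : ℝ} (h0 : t ≠ 0) (h1 : |t| < 1) :
    0 < Real.sin (Real.pi * |t|) := by
  have := abs_pos.2 h0
  apply Real.sin_pos_of_pos_of_lt_pi (by positivity)
  nlinarith [Real.pi_pos]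

/-! ### Exponential sums and the regularized pair energy. -/

/-- The modulus of the exponential sum `∑_{i = 1}^N exp (2 π i k x_i)`. -/
noncomputable def GreedySeq.expSumNorm (x : ℕ → ℝ) (N k : ℕ) : ℝ :=
  Real.sqrt ((∑ i ∈ Finset.Icc 1 N, Real.cos (2 * Real.pi * k * x i)) ^ 2
    + (∑ i ∈ Finset.Icc 1 N, Real.sin (2 * Real.pi * k * x i)) ^ 2)

namespace GreedySeq

theorem expSumNorm_nonneg (x : ℕ → ℝ) (N k : ℕ) : 0 ≤ expSumNorm x N k :=
  Real.sqrt_nonneg _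

theorem expSumNorm_sq (x : ℕ → ℝ) (N k : ℕ) :
    expSumNorm x N k ^ 2 = (∑ i ∈ Finset.Icc 1 N, Real.cos (2 * Real.pi * k * x i)) ^ 2
      + (∑ i ∈ Finset.Icc 1 N, Real.sin (2 * Real.pi * k * x i)) ^ 2 :=
  Real.sq_sqrt (by positivity)

theorem expSumNorm_sq_eq_sum_cos (x : ℕ → ℝ) (N k : ℕ) :
    expSumNorm x N k ^ 2 = ∑ i ∈ Finset.Icc 1 N, ∑ j ∈ Finset.Icc 1 N,
      Real.cos (k * (2 * Real.pi * (x i - x j))) := by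
  rw [expSumNorm_sq, sq, sq, Finset.sum_mul_sum, Finset.sum_mul_sum, ← Finset.sum_add_distrib]
  refine Finset.sum_congr rfl fun i _ => ?_
  rw [← Finset.sum_add_distrib]
  refine Finset.sum_congr rfl fun j _ => ?_
  rw [← Real.cos_sub]
  congr 1
  ring

theorem hasSum_expSumNorm_sq {r : ℝ} (h0 : 0 ≤ r) (h1 : r < 1) (x : ℕ → ℝ) (N : ℕ) :
    HasSum (fun k : ℕ => r ^ k / k * expSumNorm x N k ^ 2)
      (∑ i ∈ Finset.Icc 1 N, ∑ j ∈ Finset.Icc 1 N,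
        -(1 / 2) * Real.log (1 - 2 * r * Real.cos (2 * Real.pi * (x i - x j)) + r ^ 2)) := by
  simp_rw [expSumNorm_sq_eq_sum_cos, Finset.mul_sum]
  exact hasSum_sum fun i _ => hasSum_sum fun j _ => hasSum_pow_div_mul_cos h0 h1 _

theorem sum_expSumNorm_sq_le (x : ℕ → ℝ) (N : ℕ) {M : ℕ} (hM : 1 ≤ M) {r : ℝ}
    (hr : r = 1 - 1 / (2 * M)) :
    ∑ k ∈ Finset.Icc 1 M, expSumNorm x N k ^ 2 / k ≤
      2 * ∑ i ∈ Finset.Icc 1 N, ∑ j ∈ Finset.Icc 1 N,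
        -(1 / 2) * Real.log (1 - 2 * r * Real.cos (2 * Real.pi * (x i - x j)) + r ^ 2) := by
  have hM' : (1 : ℝ) ≤ M := by exact_mod_cast hM
  have hM2 : 1 / (2 * (M : ℝ)) ≤ 1 / 2 := by
    apply one_div_le_one_div_of_le <;> linarith
  have h0 : 0 ≤ r := by linarith
  have h1 : r < 1 := by
    have : 0 < 1 / (2 * (M : ℝ)) := by positivity
    linarith
  have h := sum_le_hasSum (Finset.Icc 1 M) (fun k _ => by positivity)
    (hasSum_expSumNorm_sq h0 h1 x N)
  refine le_trans ?_ (mul_le_mul_of_nonneg_left h zero_le_two)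
  rw [Finset.mul_sum]
  refine Finset.sum_le_sum fun k hk => ?_
  rw [Finset.mem_Icc] at hk
  have hk' : (k : ℝ) ≤ M := by exact_mod_cast hk.2
  -- Bernoulli's inequality; this is why `1 - r = 1 / (2 M)`.
  have hpow : 1 / 2 ≤ r ^ k := by
    have hb := one_add_mul_le_pow (a := -(1 / (2 * (M : ℝ)))) (by linarith) k
    have : (k : ℝ) * (1 / (2 * (M : ℝ))) ≤ 1 / 2 := by
      rw [mul_one_div, div_le_div_iff₀ (by positivity) two_pos]
      linarith
    rw [hr, sub_eq_add_neg]
    linarith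
  rw [div_mul_eq_mul_div, mul_div_assoc', ← mul_assoc]
  gcongr
  nlinarith [sq_nonneg (expSumNorm x N k)]

/-! ### An Erdős–Turán type inequality. -/

/-- Cauchy–Schwarz in the plane, and a chord of the unit circle is no longer than its arc. -/
theorem abs_sum_cos_sub_cos_le (x : ℕ → ℝ) (N k : ℕ) (s : ℝ) {δ : ℝ} (hδ : 0 ≤ δ) :
    |∑ i ∈ Finset.Icc 1 N, (Real.cos (2 * Real.pi * k * (x i - s))
        - Real.cos (2 * Real.pi * k * (x i - s - δ)))|
      ≤ expSumNorm x N k * (2 * Real.pi * k * δ) := by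
  set c := ∑ i ∈ Finset.Icc 1 N, Real.cos (2 * Real.pi * k * x i) with hc
  set d := ∑ i ∈ Finset.Icc 1 N, Real.sin (2 * Real.pi * k * x i) with hd
  set a := 2 * Real.pi * k * s with ha
  set b := 2 * Real.pi * k * (s + δ) with hb
  have hsum : ∑ i ∈ Finset.Icc 1 N, (Real.cos (2 * Real.pi * k * (x i - s))
        - Real.cos (2 * Real.pi * k * (x i - s - δ)))
      = c * (Real.cos a - Real.cos b) + d * (Real.sin a - Real.sin b) := by
    rw [hc, hd, Finset.sum_mul, Finset.sum_mul, ← Finset.sum_add_distrib]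
    refine Finset.sum_congr rfl fun i _ => ?_
    rw [show 2 * Real.pi * k * (x i - s) = 2 * Real.pi * k * x i - a by rw [ha]; ring,
      show 2 * Real.pi * k * (x i - s - δ) = 2 * Real.pi * k * x i - b by rw [hb]; ring,
      Real.cos_sub, Real.cos_sub]
    ring
  rw [hsum]
  apply abs_le_of_sq_le_sq
  · have hA : expSumNorm x N k ^ 2 = c ^ 2 + d ^ 2 := expSumNorm_sq x N k
    have hcos := Real.one_sub_sq_div_two_le_cos (x := b - a)
    rw [Real.cos_sub, show b - a = 2 * Real.pi * k * δ by rw [ha, hb]; ring] at hcos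
    have hdist : (Real.cos a - Real.cos b) ^ 2 + (Real.sin a - Real.sin b) ^ 2
        ≤ (2 * Real.pi * k * δ) ^ 2 := by
      nlinarith [Real.sin_sq_add_cos_sq a, Real.sin_sq_add_cos_sq b]
    rw [mul_pow, hA]
    refine le_trans ?_ (mul_le_mul_of_nonneg_left hdist (by positivity))
    nlinarith [sq_nonneg (c * (Real.sin a - Real.sin b) - d * (Real.cos a - Real.cos b))]
  · exact mul_nonneg (expSumNorm_nonneg x N k) (by positivity)

/-- The saw-tooth function averaged over a window of length `δ`, summed over the points `x i`. -/
noncomputable def smoothedSum (x : ℕ → ℝ) (N : ℕ) (δ s : ℝ) : ℝ :=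
  ∑ i ∈ Finset.Icc 1 N, (x i - s - δ / 2 + (|x i - s - δ| - |x i - s|) / (2 * δ))

/-- Averaging makes each summand a difference quotient of the quadratic Bernoulli polynomial, so the
series converges absolutely. -/
theorem hasSum_smoothedSum (x : ℕ → ℝ) (N : ℕ) {δ s : ℝ} (hδ : 0 < δ)
    (h1 : ∀ i ∈ Finset.Icc 1 N, |x i - s| ≤ 1) (h2 : ∀ i ∈ Finset.Icc 1 N, |x i - s - δ| ≤ 1) :
    HasSum (fun k : ℕ => 1 / (2 * δ * Real.pi ^ 2 * (k : ℝ) ^ 2) *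
        ∑ i ∈ Finset.Icc 1 N, (Real.cos (2 * Real.pi * k * (x i - s))
          - Real.cos (2 * Real.pi * k * (x i - s - δ))))
      (smoothedSum x N δ s) := by
  simp_rw [Finset.mul_sum]
  refine hasSum_sum fun i hi => ?_
  have h := ((hasSum_cos_div_sq (h1 i hi)).sub (hasSum_cos_div_sq (h2 i hi))).mul_left
    (1 / (2 * δ * Real.pi ^ 2))
  have hpi := Real.pi_ne_zero
  have hval : x i - s - δ / 2 + (|x i - s - δ| - |x i - s|) / (2 * δ)
      = 1 / (2 * δ * Real.pi ^ 2) * (Real.pi ^ 2 * ((x i - s) ^ 2 - |x i - s| + 1 / 6)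
        - Real.pi ^ 2 * ((x i - s - δ) ^ 2 - |x i - s - δ| + 1 / 6)) := by
    field_simp
    ring
  rw [hval]
  refine Eq.mpr (congrArg (fun f => HasSum f _) (funext fun k => ?_)) h
  rw [← one_div_mul_one_div]
  ring

/-- Frequencies up to `M` use the chord bound; beyond `M` the trivial bound `2 N` and `∑_{k>M} 1/k²
≤ 1/M` suffice. -/
theorem abs_smoothedSum_le (x : ℕ → ℝ) (N : ℕ) {δ s : ℝ} (hδ : 0 < δ)
    (h1 : ∀ i ∈ Finset.Icc 1 N, |x i - s| ≤ 1) (h2 : ∀ i ∈ Finset.Icc 1 N, |x i - s - δ| ≤ 1)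
    {M : ℕ} (hM : 1 ≤ M) :
    |smoothedSum x N δ s| ≤ (∑ k ∈ Finset.Icc 1 M, expSumNorm x N k / k) + N / (δ * M) := by
  have hpi : 1 ≤ Real.pi := by linarith [Real.pi_gt_three]
  have hlim := (hasSum_smoothedSum x N hδ h1 h2).tendsto_sum_nat.comp (Filter.tendsto_add_atTop_nat 1)
  refine le_of_tendsto hlim.abs ?_
  filter_upwards [Filter.eventually_ge_atTop M] with K hK
  simp only [Function.comp_apply]
  refine (Finset.abs_sum_le_sum_abs _ _).trans ?_
  have hset : Finset.range (K + 1) = insert 0 (Finset.Icc 1 M ∪ Finset.Ioc M K) := by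
    ext k
    simp only [Finset.mem_range, Finset.mem_insert, Finset.mem_union, Finset.mem_Icc,
      Finset.mem_Ioc]
    omega
  have hdisj : Disjoint (Finset.Icc 1 M) (Finset.Ioc M K) := by
    rw [Finset.disjoint_left]
    intro k hk
    simp only [Finset.mem_Icc, Finset.mem_Ioc] at hk ⊢
    omega
  rw [hset, Finset.sum_insert (by simp), Finset.sum_union hdisj]
  have hzero : ∀ a : ℝ, |1 / (2 * δ * Real.pi ^ 2 * ((0 : ℕ) : ℝ) ^ 2) * a| = 0 := by simp
  rw [hzero, zero_add]
  apply add_le_add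
  · refine Finset.sum_le_sum fun k hk => ?_
    have hk : 0 < (k : ℝ) := by exact_mod_cast (Finset.mem_Icc.1 hk).1
    have hb := abs_sum_cos_sub_cos_le x N k s hδ.le
    rw [abs_mul, abs_of_pos (by positivity)]
    refine (mul_le_mul_of_nonneg_left hb (by positivity)).trans ?_
    rw [show 1 / (2 * δ * Real.pi ^ 2 * (k : ℝ) ^ 2) * (expSumNorm x N k * (2 * Real.pi * k * δ))
      = expSumNorm x N k / (Real.pi * k) by field_simp]
    exact div_le_div_of_nonneg_left (expSumNorm_nonneg x N k) hk (by nlinarith)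
  · have hterm : ∀ k ∈ Finset.Ioc M K, |1 / (2 * δ * Real.pi ^ 2 * (k : ℝ) ^ 2) *
        ∑ i ∈ Finset.Icc 1 N, (Real.cos (2 * Real.pi * k * (x i - s))
          - Real.cos (2 * Real.pi * k * (x i - s - δ)))| ≤ N / δ * ((k : ℝ) ^ 2)⁻¹ := by
      intro k hk
      have hk : 0 < (k : ℝ) := by
        have := (Finset.mem_Ioc.1 hk).1
        exact_mod_cast (by omega : 0 < k)
      have hb : |∑ i ∈ Finset.Icc 1 N, (Real.cos (2 * Real.pi * k * (x i - s))
          - Real.cos (2 * Real.pi * k * (x i - s - δ)))| ≤ N * 2 := by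
        refine (Finset.abs_sum_le_sum_abs _ _).trans ?_
        refine (Finset.sum_le_card_nsmul _ _ 2 fun i _ => ?_).trans_eq (by simp)
        refine (abs_sub _ _).trans ?_
        linarith [Real.abs_cos_le_one (2 * Real.pi * k * (x i - s)),
          Real.abs_cos_le_one (2 * Real.pi * k * (x i - s - δ))]
      rw [abs_mul, abs_of_pos (by positivity)]
      refine (mul_le_mul_of_nonneg_left hb (by positivity)).trans ?_
      rw [show 1 / (2 * δ * Real.pi ^ 2 * (k : ℝ) ^ 2) * (N * 2)
        = N / δ * ((k : ℝ) ^ 2)⁻¹ * (1 / Real.pi ^ 2) by field_simp]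
      apply mul_le_of_le_one_right (by positivity)
      rw [div_le_one (by positivity)]
      nlinarith
    refine (Finset.sum_le_sum hterm).trans ?_
    rw [← Finset.mul_sum]
    have htail := sum_Ioc_inv_sq_le_sub (α := ℝ) (by omega : M ≠ 0) hK
    have hKinv : (0 : ℝ) ≤ (K : ℝ)⁻¹ := by positivity
    refine (mul_le_mul_of_nonneg_left (htail.trans (sub_le_self _ hKinv)) (by positivity)).trans_eq ?_
    rw [← div_eq_mul_inv, div_div]

theorem abs_card_sub_le_of_smoothedSum_le {x : ℕ → ℝ} {N : ℕ}
    (hx : ∀ i ∈ Finset.Icc 1 N, x i ∈ Set.Icc (0 : ℝ) 1) {δ E : ℝ} (hδ0 : 0 < δ) (hδ1 : δ ≤ 1)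
    (hE : ∀ s, 0 ≤ s → s + δ ≤ 1 → |smoothedSum x N δ s| ≤ E) {t : ℝ}
    (ht : t ∈ Set.Icc (0 : ℝ) 1) :
    |(((Finset.Icc 1 N).filter fun i => x i ≤ t).card : ℝ) - N * t| ≤ 2 * E + N * δ := by
  set F : ℝ → ℝ := fun t => (((Finset.Icc 1 N).filter fun i => x i ≤ t).card : ℝ) with hF
  set T := ∑ i ∈ Finset.Icc 1 N, (x i - 1 / 2) with hT
  -- Each summand on the left is a ramp in `x i`, equal to `1` up to `s` and `0` from `s + δ` on, so
  -- the sum lies between `F s` and `F (s + δ)`.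
  have hsum : ∀ s, ∑ i ∈ Finset.Icc 1 N, (1 / 2 + (|x i - s - δ| - |x i - s|) / (2 * δ))
      = smoothedSum x N δ s + N * (s + δ / 2) - T := by
    intro s
    have hN : (N : ℝ) * (s + δ / 2) = ∑ i ∈ Finset.Icc 1 N, (s + δ / 2) := by
      rw [Finset.sum_const, Nat.card_Icc, Nat.add_sub_cancel, nsmul_eq_mul]
    rw [hT, hN, smoothedSum, ← Finset.sum_add_distrib, ← Finset.sum_sub_distrib]
    refine Finset.sum_congr rfl fun i _ => ?_
    ring
  have hFsum : ∀ s, F s = ∑ i ∈ Finset.Icc 1 N, if x i ≤ s then (1 : ℝ) else 0 := by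
    intro s
    rw [hF, Finset.sum_boole]
  have hlow : ∀ s, F s ≤ smoothedSum x N δ s + N * (s + δ / 2) - T := by
    intro s
    rw [hFsum, ← hsum]
    refine Finset.sum_le_sum fun i _ => ?_
    split_ifs with h
    · rw [abs_of_nonpos (by linarith : x i - s - δ ≤ 0), abs_of_nonpos (by linarith : x i - s ≤ 0)]
      apply le_of_eq
      field_simp
      ring
    · have h1 : -δ ≤ |x i - s - δ| - |x i - s| := by
        have := abs_sub_abs_le_abs_sub (x i - s) (x i - s - δ)
        rw [sub_sub_cancel, abs_of_pos hδ0] at this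
        linarith
      have h2 : -δ / (2 * δ) ≤ (|x i - s - δ| - |x i - s|) / (2 * δ) := by gcongr
      rw [show -δ / (2 * δ) = -(1 / 2) by field_simp] at h2
      linarith
  have hup : ∀ s, smoothedSum x N δ s + N * (s + δ / 2) - T ≤ F (s + δ) := by
    intro s
    rw [hFsum, ← hsum]
    refine Finset.sum_le_sum fun i _ => ?_
    split_ifs with h
    · have h1 : |x i - s - δ| - |x i - s| ≤ δ := by
        have := abs_sub_abs_le_abs_sub (x i - s - δ) (x i - s)
        rw [sub_sub_cancel_left, abs_neg, abs_of_pos hδ0] at this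
        linarith
      have h2 : (|x i - s - δ| - |x i - s|) / (2 * δ) ≤ δ / (2 * δ) := by gcongr
      rw [show δ / (2 * δ) = 1 / 2 by field_simp] at h2
      linarith
    · rw [abs_of_nonneg (by linarith : 0 ≤ x i - s - δ), abs_of_nonneg (by linarith : 0 ≤ x i - s)]
      apply le_of_eq
      field_simp
      ring
  have hF0 : ∀ s, 0 ≤ F s := fun s => Nat.cast_nonneg _
  have hFN : ∀ s, F s ≤ N := fun s => by
    have := Finset.card_filter_le (Finset.Icc 1 N) (fun i => x i ≤ s)
    rw [Nat.card_Icc, Nat.add_sub_cancel] at this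
    exact Nat.cast_le.2 this
  have hF1 : F 1 = N := by
    rw [hFsum, Finset.sum_congr rfl fun i hi => if_pos (hx i hi).2]
    simp
  -- The unknown shift `T` is pinned down by the ends of the interval, through `F 0 ≥ 0` and `F 1 =
  -- N`.
  have hT0 : T ≤ E + N * (δ / 2) := by
    have h1 := hlow 0
    have h2 := abs_le.1 (hE 0 le_rfl (by linarith))
    rw [zero_add] at h1
    linarith [hF0 0]
  have hT1 : -E - N * (δ / 2) ≤ T := by
    have h1 := hup (1 - δ)
    have h2 := abs_le.1 (hE (1 - δ) (by linarith) (by linarith))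
    rw [sub_add_cancel, hF1] at h1
    linarith
  have hE0 : 0 ≤ E := (abs_nonneg _).trans (hE 0 le_rfl (by linarith))
  have hN0 : (0 : ℝ) ≤ N := Nat.cast_nonneg N
  change |F t - N * t| ≤ 2 * E + N * δ
  rw [abs_le]
  constructor
  · rcases le_or_gt δ t with h | h
    · have h1 := hup (t - δ)
      have h2 := abs_le.1 (hE (t - δ) (by linarith) (by linarith [ht.2]))
      rw [sub_add_cancel] at h1
      linarith
    · nlinarith [hF0 t]
  · rcases le_or_gt (t + δ) 1 with h | h
    · have h1 := hlow t
      have h2 := abs_le.1 (hE t ht.1 h)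
      linarith
    · nlinarith [hFN t]

/-! ### Energy bound at a greedy point. -/

theorem kernel_eq_coe {t : ℝ} (ht : 0 < Real.sin (Real.pi * |t|)) :
    kernel t = ((1 - Real.log (2 * Real.sin (Real.pi * t)) : ℝ) : EReal) := by
  rw [kernel, if_pos ht, log_two_sin_abs]

theorem kernel_nonneg (t : ℝ) : 0 ≤ kernel t := by
  rw [kernel]
  split_ifs
  · exact_mod_cast one_sub_log_two_sin_nonneg |t|
  · exact le_top

theorem energy_eq_coe {x : ℕ → ℝ} {n : ℕ} {y : ℝ}
    (h : ∀ k ∈ Finset.Ico 1 n, 0 < Real.sin (Real.pi * |y - x k|)) :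
    energy x n y
      = ((∑ k ∈ Finset.Ico 1 n, (1 - Real.log (2 * Real.sin (Real.pi * (y - x k)))) : ℝ) : EReal) := by
  rw [energy, Finset.sum_congr rfl fun k hk => kernel_eq_coe (h k hk)]
  exact (map_sum (⟨⟨Real.toEReal, EReal.coe_zero⟩, EReal.coe_add⟩ : ℝ →+ EReal) _ _).symm

theorem sin_pos_of_energy_lt_top {x : ℕ → ℝ} {n : ℕ} {y : ℝ} (h : energy x n y < ⊤) :
    ∀ k ∈ Finset.Ico 1 n, 0 < Real.sin (Real.pi * |y - x k|) := by
  intro k hk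
  by_contra hneg
  have h1 : kernel (y - x k) ≤ energy x n y :=
    Finset.single_le_sum (f := fun k => kernel (y - x k)) (fun k _ => kernel_nonneg _) hk
  rw [kernel, if_neg hneg] at h1
  exact absurd h (not_lt.2 h1)

/-- The points of `(0, 1)` at distance at least `ρ` from `x 1, …, x (n - 1)`. -/
def separatedSet (x : ℕ → ℝ) (n : ℕ) (ρ : ℝ) : Set ℝ :=
  Set.Ioo 0 1 \ ⋃ k ∈ Finset.Ico 1 n, Set.Ioo (x k - ρ) (x k + ρ)

theorem measurableSet_separatedSet (x : ℕ → ℝ) (n : ℕ) (ρ : ℝ) :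
    MeasurableSet (separatedSet x n ρ) :=
  measurableSet_Ioo.diff (Finset.measurableSet_biUnion _ fun _ _ => measurableSet_Ioo)

theorem le_abs_sub_of_mem_separatedSet {x : ℕ → ℝ} {n : ℕ} {ρ y : ℝ}
    (hy : y ∈ separatedSet x n ρ) {k : ℕ} (hk : k ∈ Finset.Ico 1 n) : ρ ≤ |y - x k| := by
  by_contra! h
  refine hy.2 (Set.mem_biUnion hk ?_)
  rw [abs_lt] at h
  constructor <;> linarith

theorem volume_separatedSet_ge (x : ℕ → ℝ) (n : ℕ) {ρ : ℝ} (hρ : 0 ≤ ρ) :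
    1 - 2 * ((n - 1 : ℕ) : ℝ) * ρ ≤ MeasureTheory.volume.real (separatedSet x n ρ) := by
  have h1 := MeasureTheory.le_measureReal_sdiff (μ := MeasureTheory.volume) (s₁ := Set.Ioo (0 : ℝ) 1)
    (s₂ := ⋃ k ∈ Finset.Ico 1 n, Set.Ioo (x k - ρ) (x k + ρ))
    ((MeasureTheory.measure_biUnion_lt_top (Finset.finite_toSet _)
      fun _ _ => measure_Ioo_lt_top).ne)
  have h2 := MeasureTheory.measureReal_biUnion_finset_le (μ := MeasureTheory.volume)
    (Finset.Ico 1 n) (fun k => Set.Ioo (x k - ρ) (x k + ρ))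
  have h3 : ∀ k ∈ Finset.Ico 1 n,
      MeasureTheory.volume.real (Set.Ioo (x k - ρ) (x k + ρ)) = 2 * ρ := by
    intro k _
    rw [Real.volume_real_Ioo_of_le (by linarith)]
    ring
  rw [Finset.sum_congr rfl h3, Finset.sum_const, Nat.card_Ico, nsmul_eq_mul] at h2
  rw [Real.volume_real_Ioo_of_le zero_le_one] at h1
  rw [separatedSet]
  linarith

theorem sin_pos_of_mem_separatedSet {x : ℕ → ℝ} {n : ℕ} {ρ y : ℝ} (hρ : 0 < ρ)
    (hx : ∀ k ∈ Finset.Ico 1 n, x k ∈ Set.Icc (0 : ℝ) 1) (hy : y ∈ separatedSet x n ρ) :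
    ∀ k ∈ Finset.Ico 1 n, 0 < Real.sin (Real.pi * |y - x k|) := by
  intro k hk
  have h := le_abs_sub_of_mem_separatedSet hy hk
  apply sin_pi_mul_abs_pos
  · exact abs_pos.1 (hρ.trans_le h)
  · rw [abs_lt]
    constructor <;> linarith [hy.1.1, hy.1.2, (hx k hk).1, (hx k hk).2]

theorem intervalIntegrable_energy (x : ℕ → ℝ) (n : ℕ) :
    IntervalIntegrable
      (fun y => ∑ k ∈ Finset.Ico 1 n, (1 - Real.log (2 * Real.sin (Real.pi * (y - x k)))))
      MeasureTheory.volume 0 1 := by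
  have h := IntervalIntegrable.sum (μ := MeasureTheory.volume) (a := 0) (b := 1) (Finset.Ico 1 n)
    (f := fun k y => 1 - Real.log (2 * Real.sin (Real.pi * (y - x k)))) fun k _ => by
      simpa using (intervalIntegrable_one_sub_log_two_sin (0 - x k) (1 - x k)).comp_sub_right (x k)
  simpa [Finset.sum_fn] using h

theorem integral_energy (x : ℕ → ℝ) (n : ℕ) :
    ∫ y in (0 : ℝ)..1, ∑ k ∈ Finset.Ico 1 n, (1 - Real.log (2 * Real.sin (Real.pi * (y - x k))))
      = (n - 1 : ℕ) := by
  rw [intervalIntegral.integral_finsetSum]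
  · simp only [integral_one_sub_log_two_sin]
    simp
  · intro k _
    simpa using (intervalIntegrable_one_sub_log_two_sin (0 - x k) (1 - x k)).comp_sub_right (x k)

theorem IsGreedy.mem_Icc {S : Finset ℝ} (hS : (S : Set ℝ) ⊆ Set.Icc (0 : ℝ) 1) {x : ℕ → ℝ}
    (hx : IsGreedy S x) {n : ℕ} (hn : 1 ≤ n) : x n ∈ Set.Icc (0 : ℝ) 1 := by
  rcases le_or_gt n S.card with h | h
  · apply hS
    rw [← hx.1]
    exact Set.mem_image_of_mem x ⟨hn, h⟩
  · exact (hx.2 n h).1.1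

theorem IsGreedy.sum_neg_log_le {S : Finset ℝ} (hS : (S : Set ℝ) ⊆ Set.Icc (0 : ℝ) 1) {x : ℕ → ℝ}
    (hx : IsGreedy S x) {n : ℕ} (hn : S.card < n) :
    (∀ k ∈ Finset.Ico 1 n, 0 < Real.sin (Real.pi * |x n - x k|)) ∧
      ∑ k ∈ Finset.Ico 1 n, -Real.log (2 * Real.sin (Real.pi * |x n - x k|)) ≤ 1 := by
  have hn1 : 1 ≤ n := by omega
  have hn1' : (1 : ℝ) ≤ n := by exact_mod_cast hn1
  set ρ : ℝ := (n : ℝ) ^ (-10 : ℤ) with hρ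
  have hρ0 : 0 < ρ := zpow_pos (by linarith) _
  set A := separatedSet x n ρ with hA
  set G : ℝ → ℝ :=
    fun y => ∑ k ∈ Finset.Ico 1 n, (1 - Real.log (2 * Real.sin (Real.pi * (y - x k)))) with hG
  have hmem : ∀ k ∈ Finset.Ico 1 n, x k ∈ Set.Icc (0 : ℝ) 1 := fun k hk =>
    hx.mem_Icc hS (Finset.mem_Ico.1 hk).1
  have hcast : ((n - 1 : ℕ) : ℝ) = n - 1 := by
    rw [Nat.cast_sub hn1, Nat.cast_one]
  have hvol : 1 - 2 * ((n : ℝ) - 1) * ρ ≤ MeasureTheory.volume.real A := by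
    rw [← hcast]
    exact volume_separatedSet_ge x n hρ0.le
  -- Thus `A` has measure at least `1 - 1/n`, and `(n - 1) / (1 - 1/n) = n` will bound the minimum.
  have hsmall : n * (2 * ((n : ℝ) - 1) * ρ) ≤ 1 := by
    rw [hρ, zpow_neg, ← div_eq_mul_inv, mul_div_assoc', div_le_one (by positivity)]
    have h2 : (n : ℝ) ^ 2 ≤ (n : ℝ) ^ 10 := pow_le_pow_right₀ hn1' (by norm_num)
    have h3 : (n : ℝ) ^ 3 ≤ (n : ℝ) ^ 10 := pow_le_pow_right₀ hn1' (by norm_num)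
    have hcast10 : (n : ℝ) ^ (10 : ℤ) = (n : ℝ) ^ 10 := by norm_cast
    rw [hcast10]
    rcases eq_or_lt_of_le hn1 with h | h
    · rw [← h]; norm_num
    · have h : (2 : ℝ) ≤ n := by exact_mod_cast h
      nlinarith [mul_le_mul_of_nonneg_right h (sq_nonneg (n : ℝ))]
  have hbound : ∀ y ∈ A, energy x n (x n) ≤ (G y : EReal) := by
    intro y hy
    rw [hG, ← energy_eq_coe (sin_pos_of_mem_separatedSet hρ0 hmem hy)]
    exact (hx.2 n hn).2 ⟨⟨hy.1.1.le, hy.1.2.le⟩, fun k hk => le_abs_sub_of_mem_separatedSet hy hk⟩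
  have hvol0 : 0 < MeasureTheory.volume.real A := by
    have : n * (2 * ((n : ℝ) - 1) * ρ) < n * 1 := by
      rcases eq_or_lt_of_le hn1 with h | h
      · rw [← h]; norm_num
      · have h : (1 : ℝ) < n := by exact_mod_cast h
        linarith
    have := lt_of_mul_lt_mul_left this (by linarith)
    linarith
  obtain ⟨y₀, hy₀⟩ : A.Nonempty := by
    by_contra hne
    rw [Set.not_nonempty_iff_eq_empty] at hne
    simp [hne] at hvol0
  -- Admissibility alone allows `|x n - x k| = 1`, where the kernel is infinite; a competitor of
  -- finite energy rules this out.
  have hsin := sin_pos_of_energy_lt_top ((hbound y₀ hy₀).trans_lt (EReal.coe_lt_top _))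
  refine ⟨hsin, ?_⟩
  have hmin : ∀ y ∈ A, G (x n) ≤ G y := by
    intro y hy
    have h := hbound y hy
    rw [energy_eq_coe hsin] at h
    exact_mod_cast h
  have hAsub : A ⊆ Set.Ioc 0 1 := fun y hy => ⟨hy.1.1, hy.1.2.le⟩
  have hint : MeasureTheory.IntegrableOn G (Set.Ioc 0 1) :=
    (intervalIntegrable_iff_integrableOn_Ioc_of_le zero_le_one).1 (intervalIntegrable_energy x n)
  have hle : G (x n) * MeasureTheory.volume.real A ≤ n - 1 := by
    rw [← hcast, ← integral_energy x n, intervalIntegral.integral_of_le zero_le_one]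
    refine (MeasureTheory.setIntegral_ge_of_const_le_real (measurableSet_separatedSet x n ρ) ?_ hmin
      (hint.mono_set hAsub)).trans ?_
    · exact ((MeasureTheory.measure_mono hAsub).trans_lt measure_Ioc_lt_top).ne
    · refine MeasureTheory.setIntegral_mono_set hint ?_ hAsub.eventuallyLE
      exact Filter.Eventually.of_forall fun y =>
        Finset.sum_nonneg fun k _ => one_sub_log_two_sin_nonneg _
  have hGn : G (x n) ≤ n := by
    by_contra! h
    have := mul_lt_mul_of_pos_right h hvol0
    nlinarith
  have hGsum : ∑ k ∈ Finset.Ico 1 n, -Real.log (2 * Real.sin (Real.pi * |x n - x k|))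
      = G (x n) - (n - 1) := by
    simp only [log_two_sin_abs, hG, Finset.sum_sub_distrib, Finset.sum_neg_distrib,
      Finset.sum_const, Nat.card_Ico, nsmul_eq_mul, hcast]
    ring
  rw [hGsum]
  linarith

/-! ### Bounds for the exponential sums of a greedy sequence. -/

theorem sum_sum_eq_diag_add_two_mul {q : ℕ → ℕ → ℝ} (hq : ∀ i j, q i j = q j i) (N : ℕ) :
    ∑ i ∈ Finset.Icc 1 N, ∑ j ∈ Finset.Icc 1 N, q i j
      = ∑ i ∈ Finset.Icc 1 N, q i i + 2 * ∑ i ∈ Finset.Icc 1 N, ∑ k ∈ Finset.Ico 1 i, q i k := by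
  induction N with
  | zero => simp
  | succ N ih =>
    have hIco : Finset.Ico 1 (N + 1) = Finset.Icc 1 N := by
      ext
      simp only [Finset.mem_Ico, Finset.mem_Icc]
      omega
    simp only [Finset.sum_Icc_succ_top (Nat.le_add_left 1 N), Finset.sum_add_distrib, ih, hIco,
      hq _ (N + 1)]
    ring

/-- Pairs inside `S` may have infinite kernel (`0` and `1` both in `S`), so they get the uniform
bound `L`; later indices use the greedy bound. -/
theorem IsGreedy.sum_poisson_le {S : Finset ℝ} (hS : (S : Set ℝ) ⊆ Set.Icc (0 : ℝ) 1) {x : ℕ → ℝ}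
    (hx : IsGreedy S x) {r L ε : ℝ} (hr0 : 0 < r) (hr1 : r < 1) (hL : -Real.log (1 - r) ≤ L)
    (hε : 1 / 2 * (1 / r - 1) ≤ ε) {n : ℕ} (hnε : n * ε ≤ 1) (hε0 : 0 ≤ ε) :
    ∑ k ∈ Finset.Ico 1 n,
        -(1 / 2) * Real.log (1 - 2 * r * Real.cos (2 * Real.pi * (x n - x k)) + r ^ 2)
      ≤ 2 + S.card * L := by
  have hL0 : 0 ≤ L := le_trans (by linarith [Real.log_nonpos (by linarith) (by linarith : 1 - r ≤ 1)]) hL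
  rcases le_or_gt n S.card with h | h
  · refine (Finset.sum_le_card_nsmul _ _ L fun k _ =>
      (log_poisson_le_neg_log_one_sub hr0.le hr1 _).trans hL).trans ?_
    rw [Nat.card_Ico, nsmul_eq_mul]
    have : ((n - 1 : ℕ) : ℝ) ≤ S.card := by exact_mod_cast (by omega : n - 1 ≤ S.card)
    nlinarith
  · obtain ⟨hsin, hsum⟩ := hx.sum_neg_log_le hS h
    have hle : ∑ k ∈ Finset.Ico 1 n,
        -(1 / 2) * Real.log (1 - 2 * r * Real.cos (2 * Real.pi * (x n - x k)) + r ^ 2)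
        ≤ ∑ k ∈ Finset.Ico 1 n, (-Real.log (2 * Real.sin (Real.pi * |x n - x k|)) + ε) :=
      Finset.sum_le_sum fun k hk =>
        (log_poisson_le_neg_log_sin hr0 _ (hsin k hk)).trans (by linarith)
    rw [Finset.sum_add_distrib, Finset.sum_const, Nat.card_Ico, nsmul_eq_mul] at hle
    have hcast : ((n - 1 : ℕ) : ℝ) ≤ n := by exact_mod_cast Nat.sub_le n 1
    have := mul_le_mul_of_nonneg_right hcast hε0
    have : 0 ≤ S.card * L := by positivity
    linarith

theorem half_le_log {N : ℕ} (hN : 2 ≤ N) : 1 / 2 ≤ Real.log N := by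
  have h := Real.log_le_log two_pos (by exact_mod_cast hN : (2 : ℝ) ≤ N)
  linarith [Real.log_two_gt_d9]

theorem IsGreedy.sum_expSumNorm_sq_le {S : Finset ℝ} (hS : (S : Set ℝ) ⊆ Set.Icc (0 : ℝ) 1)
    {x : ℕ → ℝ} (hx : IsGreedy S x) {N : ℕ} (hN : 2 ≤ N) :
    ∑ k ∈ Finset.Icc 1 (N ^ 2), expSumNorm x N k ^ 2 / k
      ≤ 2 * (11 + 6 * S.card) * (N * Real.log N) := by
  have hN' : (2 : ℝ) ≤ N := by exact_mod_cast hN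
  have hL := half_le_log hN
  set L := Real.log N with hLdef
  set r : ℝ := 1 - 1 / (2 * ((N ^ 2 : ℕ) : ℝ)) with hr
  have hcast : ((N ^ 2 : ℕ) : ℝ) = (N : ℝ) ^ 2 := by push_cast; rfl
  have hsq : 2 * (N : ℝ) ≤ (N : ℝ) ^ 2 := by nlinarith
  have hr1 : r < 1 := by
    have : 0 < 1 / (2 * ((N ^ 2 : ℕ) : ℝ)) := by positivity
    linarith
  have hreq : r = (2 * (N : ℝ) ^ 2 - 1) / (2 * (N : ℝ) ^ 2) := by
    rw [hr, hcast]
    field_simp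
  have hr0 : 0 < r := by
    rw [hreq]
    apply div_pos <;> nlinarith
  -- Here `-log (1 - r) = log 2 + 2 log N`, and `log 2 ≤ log N`.
  have hlog : -Real.log (1 - r) ≤ 3 * L := by
    rw [hr, sub_sub_cancel, one_div, Real.log_inv, neg_neg, hcast, Real.log_mul two_ne_zero
      (by positivity), Real.log_pow]
    have := Real.log_le_log two_pos hN'
    push_cast
    linarith
  have hε : 1 / 2 * (1 / r - 1) ≤ 1 / (N : ℝ) := by
    have hpos : 0 < 2 * (N : ℝ) ^ 2 - 1 := by nlinarith
    rw [hreq, one_div_div, div_sub_one hpos.ne', ← mul_div_mul_comm,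
      div_le_div_iff₀ (by positivity) (by positivity)]
    nlinarith
  refine (GreedySeq.sum_expSumNorm_sq_le x N (by nlinarith : 1 ≤ N ^ 2) hr).trans ?_
  rw [sum_sum_eq_diag_add_two_mul (fun i j => by
    rw [← Real.cos_neg, ← mul_neg, neg_sub])]
  have h1 : ∑ i ∈ Finset.Icc 1 N,
      -(1 / 2) * Real.log (1 - 2 * r * Real.cos (2 * Real.pi * (x i - x i)) + r ^ 2)
      ≤ N * (3 * L) := by
    refine (Finset.sum_le_card_nsmul _ _ (3 * L) fun i _ =>
      (log_poisson_le_neg_log_one_sub hr0.le hr1 _).trans hlog).trans_eq ?_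
    rw [Nat.card_Icc, Nat.add_sub_cancel, nsmul_eq_mul]
  have h2 : ∑ i ∈ Finset.Icc 1 N, ∑ k ∈ Finset.Ico 1 i,
      -(1 / 2) * Real.log (1 - 2 * r * Real.cos (2 * Real.pi * (x i - x k)) + r ^ 2)
      ≤ N * (2 + S.card * (3 * L)) := by
    refine (Finset.sum_le_card_nsmul _ _ (2 + S.card * (3 * L)) fun i hi =>
      hx.sum_poisson_le hS hr0 hr1 hlog hε ?_ (by positivity)).trans_eq ?_
    · rw [mul_one_div]
      apply div_le_one_of_le₀ _ (by positivity)
      exact_mod_cast (Finset.mem_Icc.1 hi).2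
    · rw [Nat.card_Icc, Nat.add_sub_cancel, nsmul_eq_mul]
  nlinarith

theorem IsGreedy.sum_expSumNorm_div_le {S : Finset ℝ} (hS : (S : Set ℝ) ⊆ Set.Icc (0 : ℝ) 1)
    {x : ℕ → ℝ} (hx : IsGreedy S x) {N : ℕ} (hN : 2 ≤ N) :
    ∑ k ∈ Finset.Icc 1 (N ^ 2), expSumNorm x N k / k
      ≤ Real.sqrt (8 * (11 + 6 * S.card)) * (Real.sqrt N * Real.log N) := by
  have hL := half_le_log hN
  have hharm : ∑ k ∈ Finset.Icc 1 (N ^ 2), 1 / (k : ℝ) ≤ 4 * Real.log N := by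
    have h := harmonic_le_one_add_log (N ^ 2)
    rw [harmonic_eq_sum_Icc] at h
    push_cast at h
    rw [Real.log_pow] at h
    simp only [one_div]
    push_cast at h
    linarith
  have hcs := Finset.sum_sq_le_sum_mul_sum_of_sq_le_mul (Finset.Icc 1 (N ^ 2))
    (r := fun k => expSumNorm x N k / k) (f := fun k => expSumNorm x N k ^ 2 / k)
    (g := fun k => 1 / (k : ℝ)) (fun k _ => by positivity) (fun k _ => by positivity)
    (fun k _ => by rw [div_mul_div_comm, mul_one, div_pow, sq (k : ℝ)])
  have hprod := mul_le_mul (hx.sum_expSumNorm_sq_le hS hN) hharm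
    (Finset.sum_nonneg fun k _ => by positivity) (by positivity)
  refine (sq_le_sq₀ (Finset.sum_nonneg fun k _ => div_nonneg (expSumNorm_nonneg x N k) (Nat.cast_nonneg k))
    (by positivity)).1 ?_
  refine (hcs.trans hprod).trans_eq ?_
  rw [mul_pow, mul_pow, Real.sq_sqrt (by positivity), Real.sq_sqrt (by positivity)]
  ring

/-! ### From counting errors to the star discrepancy. -/

theorem starDiscrepancy_le {x : ℕ → ℝ} {N : ℕ} (hN : 0 < N) {b : ℝ} (hb : 0 ≤ b)
    (h : ∀ t ∈ Set.Icc (0 : ℝ) 1,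
      |(((Finset.Icc 1 N).filter fun i => x i ≤ t).card : ℝ) - N * t| ≤ N * b) :
    starDiscrepancy x N ≤ b := by
  have hN' : (0 : ℝ) < N := by exact_mod_cast hN
  refine Real.iSup_le (fun t => ?_) hb
  have hset : {i : ℕ | 1 ≤ i ∧ i ≤ N ∧ x i ≤ (t : ℝ)}
      = ((Finset.Icc 1 N).filter fun i => x i ≤ (t : ℝ) : Finset ℕ) := by
    ext i
    simp [and_assoc]
  rw [hset, Set.ncard_coe_finset, div_sub' hN'.ne', abs_div, abs_of_pos hN', div_le_iff₀ hN',
    mul_comm b]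
  exact h t t.2

end GreedySeq

theorem theorem1 (S : Finset ℝ) (hS : (S : Set ℝ) ⊆ Set.Icc (0 : ℝ) 1) :
    ∃ C : ℝ, ∀ x : ℕ → ℝ, GreedySeq.IsGreedy S x →
      ∀ N : ℕ, 2 ≤ N →
        GreedySeq.starDiscrepancy x N ≤ C * (Real.log (N : ℝ) / Real.sqrt (N : ℝ)) := by
  refine ⟨6 + 2 * Real.sqrt (8 * (11 + 6 * S.card)), fun x hx N hN => ?_⟩
  have hN' : (2 : ℝ) ≤ N := by exact_mod_cast hN
  have hL := GreedySeq.half_le_log hN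
  have hsum := hx.sum_expSumNorm_div_le hS hN
  have hmem : ∀ i ∈ Finset.Icc 1 N, x i ∈ Set.Icc (0 : ℝ) 1 := fun i hi =>
    hx.mem_Icc hS (Finset.mem_Icc.1 hi).1
  set c := Real.sqrt (8 * (11 + 6 * (S.card : ℝ)))
  -- With window `δ = 1/N` and cutoff `M = N²`, both `N δ` and the tail `N / (δ M)` equal `1`.
  have hδ0 : 0 < 1 / (N : ℝ) := by positivity
  have hδ1 : 1 / (N : ℝ) ≤ 1 := by
    rw [div_le_one (by positivity)]
    linarith
  have hE : ∀ s, 0 ≤ s → s + 1 / (N : ℝ) ≤ 1 →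
      |GreedySeq.smoothedSum x N (1 / N) s| ≤ c * (Real.sqrt N * Real.log N) + 1 := by
    intro s hs0 hs1
    refine (GreedySeq.abs_smoothedSum_le x N hδ0 (fun i hi => ?_) (fun i hi => ?_)
      (by nlinarith : 1 ≤ N ^ 2)).trans (add_le_add hsum (le_of_eq ?_))
    · have := hmem i hi
      rw [abs_le]
      constructor <;> linarith [this.1, this.2]
    · have := hmem i hi
      rw [abs_le]
      constructor <;> linarith [this.1, this.2]
    · push_cast
      field_simp
  refine GreedySeq.starDiscrepancy_le (by omega) (by positivity) fun t ht =>
    (GreedySeq.abs_card_sub_le_of_smoothedSum_le hmem hδ0 hδ1 hE ht).trans ?_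
  have hq : Real.sqrt N * Real.sqrt N = N := Real.mul_self_sqrt (by positivity)
  have hq1 : 1 ≤ Real.sqrt N := Real.one_le_sqrt.2 (by linarith)
  have hrhs : (N : ℝ) * ((6 + 2 * c) * (Real.log N / Real.sqrt N))
      = (6 + 2 * c) * (Real.sqrt N * Real.log N) := by
    nth_rewrite 1 [← hq]
    field_simp
  rw [hrhs, mul_one_div_cancel (by positivity)]
  -- The leftover `2 + 1` is absorbed by `6 √N log N`, as `log N ≥ 1/2`.
  nlinarith
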